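/- Let $H$ be a finite-dimensional complex Hilbert space with a fixed orthonormal basis, let $t$ (written $b\mapsto b^t$) be the transpose map on $B(H)$ with respect to this basis, let $\mathrm{Tr}$ be the usual trace, and let $\iota$ denote the identity map. Let $P(H)$ and $CP(H)$ be the sets of positive, respectively completely positive, linear maps of $B(H)$ into itself. A mapping cone on $B(H)$ is a closed convex cone $\mathcal K\subset P(H)$ (containing $0$) such that $\alpha\circ\psi\in\mathcal K$ and $\psi\circ\beta\in\mathcal K$ for all $\psi\in\mathcal K$ and $\alpha,\beta\in CP(H)$. It is symmetric if for every linear map $\psi:B(H)\to B(H)$ one has $\psi\in\mathcal K\iff\psi^*\in\mathcal K\iff t\circ\psi\circ t\in\mathcal K$, where $\psi^*$ is defined by $\mathrm{Tr}(\psi(a)b)=\mathrm{Tr}(a\psi^*(b))$ for all $a,b\in B(H)$. Let $A\subset B(H)$ be an operator system, i.e. a (closed) self-adjoint linear subspace containing the identity operator, and put $$P(A,\mathcal K)=\{x\in A\otimes B(H):(\iota\otimes\alpha)(x)\ge 0\ \text{ for all }\alpha\in\mathcal K\},$$ where positivity is that of operators on $H\otimes H$. For a linear map $\varphi:A\to B(H)$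 let $\tilde\varphi$ be the linear functional on $A\otimes B(H)$ with $\tilde\varphi(a\otimes b)=\mathrm{Tr}(\varphi(a)b^t)$, and call $\varphi$ $\mathcal K$-positive if $\tilde\varphi(x)\ge 0$ for all $x\in P(A,\mathcal K)$. **Theorem.** Let $\mathcal K$ be a symmetric mapping cone on $B(H)$ and let $\varphi:A\to B(H)$ be a positive linear map (that is, $\varphi(a)\ge 0$ whenever $a\in A$ and $a\ge 0$). Then $\varphi$ is $\mathcal K$-positive if and only if $\varphi$ is the restriction to $A$ of a map belonging to $\mathcal K$. -/

import Mathlib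

namespace MappingCones

open scoped TensorProduct ComplexOrder

noncomputable section

/-- `B(H)`, the bounded operators on `H`, with the operator norm and the Loewner order. -/
abbrev BH (H : Type*) [NormedAddCommGroup H] [InnerProductSpace ℂ H] : Type _ := H →L[ℂ] H

/-- The linear maps of `B(H)` into itself (for finite dimensional `H` every linear map is
continuous), with the norm topology. -/
abbrev Maps (H : Type*) [NormedAddCommGroup H] [InnerProductSpace ℂ H] : Type _ := BH H →L[ℂ] BH H

section

variable {H : Type*} [NormedAddCommGroup H] [InnerProductSpace ℂ H]

/-- An operator system in `B(H)`: a closed self-adjoint linear subspace containing the identity. -/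
structure IsOperatorSystem [CompleteSpace H] (A : Submodule ℂ (BH H)) : Prop where
  one_mem : (1 : BH H) ∈ A
  star_mem : ∀ a ∈ A, star a ∈ A
  isClosed : IsClosed (A : Set (BH H))

/-- A linear map `φ : A → B(H)` is positive if it maps positive operators to positive operators. -/
def IsPositiveMap {A : Submodule ℂ (BH H)} (φ : A →ₗ[ℂ] BH H) : Prop :=
  ∀ a : A, 0 ≤ (a : BH H) → 0 ≤ φ a

variable (H) in
/-- `P(H)`, the positive linear maps of `B(H)` into itself. -/
def positiveMaps : Set (Maps H) := {φ | ∀ a : BH H, 0 ≤ a → 0 ≤ φ a}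

variable (H) in
/-- `CP(H)`, the completely positive linear maps of `B(H)` into itself. -/
def cpMaps [CompleteSpace H] : Set (Maps H) := {φ | ∃ f : CompletelyPositiveMap (BH H) (BH H), ∀ a, φ a = f a}

/-- A mapping cone on `B(H)`: a closed convex cone of positive maps, stable under composition with
completely positive maps on either side. -/
structure IsMappingCone [CompleteSpace H] (K : PointedCone ℝ (Maps H)) : Prop where
  isClosed : IsClosed (K : Set (Maps H))
  positive : ∀ φ ∈ K, φ ∈ positiveMaps H
  comp_left : ∀ φ ∈ K, ∀ α ∈ cpMaps H, α.comp φ ∈ K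
  comp_right : ∀ φ ∈ K, ∀ β ∈ cpMaps H, φ.comp β ∈ K

/-- The trace of an operator on `H`. -/
def tr (a : BH H) : ℂ := LinearMap.trace ℂ H (a : H →ₗ[ℂ] H)

/-- The inclusion `A ⊗ B(H) → B(H ⊗ H)`, `a ⊗ b ↦ a ⊗ b`. -/
def toOperator (A : Submodule ℂ (BH H)) : A ⊗[ℂ] BH H →ₗ[ℂ] BH (H ⊗[ℂ] H) :=
  TensorProduct.lift (LinearMap.mk₂ ℂ
    (fun (a : A) (b : BH H) => TensorProduct.mapL (a : BH H) b)
    (fun a a' b => by ext z; simp [TensorProduct.map_add_left])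
    (fun c a b => by ext z; simp [TensorProduct.map_smul_left])
    (fun a b b' => by ext z; simp [TensorProduct.map_add_right])
    (fun c a b => by ext z; simp [TensorProduct.map_smul_right]))

/-- The cone `P(A, K) = {x ∈ A ⊗ B(H) : (ι ⊗ α)(x) ≥ 0 for all α ∈ K}`. -/
def conePAK (A : Submodule ℂ (BH H)) (K : PointedCone ℝ (Maps H)) : Set (A ⊗[ℂ] BH H) :=
  {x | ∀ α ∈ K, 0 ≤ toOperator A (LinearMap.lTensor A (α : BH H →ₗ[ℂ] BH H) x)}

end

section

variable {H : Type*} [NormedAddCommGroup H] [InnerProductSpace ℂ H] {ι : Type*} [Fintype ι]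

/-- The matrix units of `B(H)` for the orthonormal basis `e`: `x ↦ ⟪e j, x⟫ e i`. -/
def matrixUnit (e : OrthonormalBasis ι ℂ H) (i j : ι) : BH H :=
  InnerProductSpace.rankOne ℂ (e i) (e j)

theorem sum_matrixUnit (e : OrthonormalBasis ι ℂ H) (a : BH H) :
    ∑ i, ∑ j, (inner ℂ (e i) (a (e j))) • matrixUnit e i j = a := by
  classical
  apply ContinuousLinearMap.coe_injective
  refine e.toBasis.ext fun k => ?_
  simp [matrixUnit, OrthonormalBasis.inner_eq_ite, e.sum_repr']

variable [FiniteDimensional ℂ H]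

/-- The transpose map `t` on `B(H)` with respect to the orthonormal basis `e`: if
`a = ∑ i, ∑ j, a i j • matrixUnit e i j`, then `aᵗ = ∑ i, ∑ j, a i j • matrixUnit e j i`. -/
def transposeMap (e : OrthonormalBasis ι ℂ H) : Maps H :=
  LinearMap.toContinuousLinearMap
    { toFun := fun a => ∑ i, ∑ j, (inner ℂ (e i) (a (e j)) : ℂ) • matrixUnit e j i
      map_add' := fun a b => by
        simp only [add_apply, inner_add_right, add_smul, Finset.sum_add_distrib]
      map_smul' := fun c a => by
        simp only [smul_apply, inner_smul_right, mul_smul, Finset.smul_sum, RingHom.id_apply] }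

/-- `φᵗ = t ∘ φ ∘ t`. -/
def mapTranspose (e : OrthonormalBasis ι ℂ H) (φ : Maps H) : Maps H :=
  (transposeMap e).comp (φ.comp (transposeMap e))

/-- The adjoint `φ*` of `φ` for the trace pairing: the unique map with
`Tr(φ(a) b) = Tr(a φ*(b))` for all `a, b` (see `tr_mul_mapAdjoint` and `eq_mapAdjoint`). -/
def mapAdjoint (e : OrthonormalBasis ι ℂ H) (φ : Maps H) : Maps H :=
  LinearMap.toContinuousLinearMap
    { toFun := fun b => ∑ i, ∑ j, tr (φ (matrixUnit e i j) * b) • matrixUnit e j i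
      map_add' := fun b c => by
        simp only [mul_add, tr, ContinuousLinearMap.toLinearMap_add, map_add, add_smul,
          Finset.sum_add_distrib]
      map_smul' := fun c b => by
        simp only [mul_smul_comm, tr, ContinuousLinearMap.toLinearMap_smul, map_smul, smul_eq_mul,
          mul_smul, Finset.smul_sum, RingHom.id_apply] }

/-- `φ̃`, the linear functional on `A ⊗ B(H)` with `φ̃(a ⊗ b) = Tr(φ(a) bᵗ)`. -/
def tildeFunctional (e : OrthonormalBasis ι ℂ H) {A : Submodule ℂ (BH H)} (φ : A →ₗ[ℂ] BH H) :
    A ⊗[ℂ] BH H →ₗ[ℂ] ℂ :=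
  TensorProduct.lift (LinearMap.mk₂ ℂ
    (fun (a : A) (b : BH H) => tr (φ a * transposeMap e b))
    (fun a a' b => by simp only [tr, map_add, add_mul, ContinuousLinearMap.toLinearMap_add])
    (fun c a b => by simp only [tr, map_smul, smul_mul_assoc, ContinuousLinearMap.toLinearMap_smul])
    (fun a b b' => by simp only [tr, map_add, mul_add, ContinuousLinearMap.toLinearMap_add])
    (fun c a b => by
      simp only [tr, map_smul, mul_smul_comm, ContinuousLinearMap.toLinearMap_smul]))

/-- The mapping cone `K` is symmetric: `φ ∈ K` iff `φ* ∈ K` iff `φᵗ ∈ K`. -/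
structure IsSymmetric (e : OrthonormalBasis ι ℂ H) (K : PointedCone ℝ (Maps H)) : Prop where
  mem_iff_adjoint : ∀ φ : Maps H, φ ∈ K ↔ mapAdjoint e φ ∈ K
  mem_iff_transpose : ∀ φ : Maps H, φ ∈ K ↔ mapTranspose e φ ∈ K

/-- `φ : A → B(H)` is `K`-positive: `φ̃` takes nonnegative (real) values on `P(A, K)`. -/
def IsKPositive (e : OrthonormalBasis ι ℂ H) {A : Submodule ℂ (BH H)}
    (K : PointedCone ℝ (Maps H)) (φ : A →ₗ[ℂ] BH H) : Prop :=
  ∀ x ∈ conePAK A K, 0 ≤ tildeFunctional e φ x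

/-- `aᵗ` has the transposed matrix of `a` in the basis `e`. -/
theorem inner_transposeMap (e : OrthonormalBasis ι ℂ H) (a : BH H) (i j : ι) :
    inner ℂ (e i) (transposeMap e a (e j)) = inner ℂ (e j) (a (e i)) := by
  classical
  have h : transposeMap e a = ∑ i, ∑ j, (inner ℂ (e i) (a (e j)) : ℂ) • matrixUnit e j i := rfl
  simp [h, matrixUnit, OrthonormalBasis.inner_eq_ite]

theorem tr_mul_matrixUnit (e : OrthonormalBasis ι ℂ H) (a : BH H) (i j : ι) :
    tr (a * matrixUnit e j i) = inner ℂ (e i) (a (e j)) := by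
  have h : a * matrixUnit e j i = InnerProductSpace.rankOne ℂ (a (e j)) (e i) := by
    ext x; simp [matrixUnit]
  rw [tr, h, InnerProductSpace.trace_rankOne]

theorem tr_mul_mapAdjoint (e : OrthonormalBasis ι ℂ H) (φ : Maps H) (a b : BH H) :
    tr (φ a * b) = tr (a * mapAdjoint e φ b) := by
  have h1 : mapAdjoint e φ b = ∑ i, ∑ j, tr (φ (matrixUnit e i j) * b) • matrixUnit e j i := rfl
  have h2 : tr (a * mapAdjoint e φ b)
      = ∑ i, ∑ j, tr (φ (matrixUnit e i j) * b) * inner ℂ (e i) (a (e j)) := by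
    simp only [← tr_mul_matrixUnit, h1, tr, Finset.mul_sum, mul_smul_comm,
      ContinuousLinearMap.toLinearMap_sum, ContinuousLinearMap.toLinearMap_smul, map_sum, map_smul,
      smul_eq_mul]
  rw [h2]
  conv_lhs => rw [← sum_matrixUnit e a]
  simp only [tr, map_sum, map_smul, Finset.sum_mul, smul_mul_assoc,
    ContinuousLinearMap.toLinearMap_sum, ContinuousLinearMap.toLinearMap_smul, smul_eq_mul, mul_comm]

theorem eq_mapAdjoint (e : OrthonormalBasis ι ℂ H) (φ ψ : Maps H)
    (h : ∀ a b : BH H, tr (φ a * b) = tr (a * ψ b)) : ψ = mapAdjoint e φ := by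
  ext1 b
  rw [← sum_matrixUnit e (ψ b), ← sum_matrixUnit e (mapAdjoint e φ b)]
  refine Finset.sum_congr rfl fun i _ => Finset.sum_congr rfl fun j _ => ?_
  have key : ∀ c : BH H, inner ℂ (e i) (c (e j)) = tr (matrixUnit e j i * c) := fun c => by
    rw [← tr_mul_matrixUnit]
    exact LinearMap.trace_mul_comm ℂ (c : H →ₗ[ℂ] H) (matrixUnit e j i : H →ₗ[ℂ] H)
  rw [key, key, ← h, tr_mul_mapAdjoint e]

end

end

end MappingCones

/-!
Let `Ω = ∑ i, e i ⊗ e i`. The functional `a ⊗ b ↦ Tr(a bᵗ)` is `y ↦ ⟪Ω, y Ω⟫`, hence positive, and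
moving `ψ` across the trace gives `ψ̃ = ι̃ ∘ (ι ⊗ α)` with `α = (ψ*)ᵗ`, which lies in the symmetric
cone `K` whenever `ψ` does. So the restriction to `A` of a map in `K` is `K`-positive.

Conversely, every vector of `H ⊗ H` is `(1 ⊗ v) Ω` for some `v ∈ B(H)`, so that `(ι ⊗ α)(x) ≥ 0`
says that `ι̃ ((ι ⊗ (Ad v ∘ α)) x) ≥ 0` for all `v`. Since `Ad v ∘ α ∈ K` for `α ∈ K`, an element `x`
is in `P(A, K)` as soon as `ψ̃(x) ≥ 0` for all `ψ ∈ K` (`mem_conePAK_of_nonneg`): the cones `P(A, K)`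
and `K|_A` are dual to each other. The restrictions to `A` of the maps in `K` form a closed cone,
because a positive map `ψ` satisfies `‖ψ‖ ≤ 4 ‖ψ 1‖` and `1 ∈ A` (`isClosed_image_restrict`). If `φ`
is not in it, Hahn-Banach gives a real functional `f`, nonnegative on the cone and negative at `φ`.
Averaging `f` over the involution `θ ↦ θ(·*)*` and complexifying gives a complex functional that is
real on all positive maps. Like every complex functional it has the form `θ ↦ θ̃(x)`
(`exists_tildeFunctional_eq`); then `x ∈ P(A, K)` and `φ̃(x) < 0`, so `φ` is not `K`-positive.
-/

namespace MappingCones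

open scoped TensorProduct ComplexOrder

section

variable {H : Type*} [NormedAddCommGroup H] [InnerProductSpace ℂ H]

/-! ### The trace and operators on `H ⊗ H` -/

theorem tr_mul_comm (a b : BH H) : tr (a * b) = tr (b * a) :=
  LinearMap.trace_mul_comm ℂ (a : H →ₗ[ℂ] H) (b : H →ₗ[ℂ] H)

theorem toOperator_tmul (A : Submodule ℂ (BH H)) (a : A) (b : BH H) :
    toOperator A (a ⊗ₜ b) = TensorProduct.mapL (a : BH H) b := by
  simp [toOperator]

/-! ### Positive maps preserve adjoints -/

/-- A positive map on an operator system commutes with taking adjoints, because every self-adjoint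
`b ∈ A` is the difference of `b + ‖b‖ ≥ 0` and `‖b‖ ≥ 0`, both in `A`. -/
theorem IsPositiveMap.star_apply [CompleteSpace H] {A : Submodule ℂ (BH H)}
    (hA : IsOperatorSystem A) {φ : A →ₗ[ℂ] BH H} (hφ : IsPositiveMap φ) (a : A) :
    φ ⟨star (a : BH H), hA.star_mem a a.2⟩ = star (φ a) := by
  let one : A := ⟨1, hA.one_mem⟩
  have sa : ∀ b : A, IsSelfAdjoint (b : BH H) → IsSelfAdjoint (φ b) := fun b hb => by
    have h1 : IsSelfAdjoint (φ one) :=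
      .of_nonneg (hφ _ (zero_le_one : (0 : BH H) ≤ 1))
    have h2 : 0 ≤ φ (b + ((‖(b : BH H)‖ : ℝ) : ℂ) • one) := by
      refine hφ _ ?_
      have := hb.neg_algebraMap_norm_le_self
      rw [Algebra.algebraMap_eq_smul_one, neg_le_iff_add_nonneg'] at this
      simpa [one, add_comm] using this
    have h3 : φ b = φ (b + ((‖(b : BH H)‖ : ℝ) : ℂ) • one) - (‖(b : BH H)‖ : ℝ) • φ one := by
      simp
    rw [h3]
    exact (IsSelfAdjoint.of_nonneg h2).sub ((IsSelfAdjoint.all _).smul h1)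
  let a' : A := ⟨star (a : BH H), hA.star_mem a a.2⟩
  have hr : star (φ (a + a')) = φ (a + a') :=
    (sa _ (by simp [a', isSelfAdjoint_iff, add_comm])).star_eq
  have hi : star (φ (Complex.I • (a - a'))) = φ (Complex.I • (a - a')) :=
    (sa _ (by simp [a', isSelfAdjoint_iff, smul_sub, neg_add_eq_sub])).star_eq
  have hi' : star (φ a) - star (φ a') = - (φ a - φ a') := by
    have : -Complex.I • (star (φ a) - star (φ a')) = Complex.I • (φ a - φ a') := by
      simpa [smul_sub] using hi
    rw [neg_smul, neg_eq_iff_eq_neg, ← smul_neg] at this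
    exact smul_right_injective _ Complex.I_ne_zero this
  have hr' : star (φ a) + star (φ a') = φ a + φ a' := by simpa using hr
  change φ a' = star (φ a)
  have h2 : (2 : ℂ) • φ a' = (2 : ℂ) • star (φ a) := calc
    _ = (φ a + φ a') + -(φ a - φ a') := by module
    _ = _ := by rw [← hr', ← hi']; module
  exact smul_right_injective _ two_ne_zero h2

/-- The map `a ↦ φ(a*)*`, which equals `φ` exactly when `φ` preserves adjoints. -/
noncomputable def hermConj [CompleteSpace H] {A : Submodule ℂ (BH H)} (hA : IsOperatorSystem A) :
    (A →ₗ[ℂ] BH H) →ₗ[ℝ] (A →ₗ[ℂ] BH H) where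
  toFun φ :=
    { toFun := fun a => star (φ ⟨star (a : BH H), hA.star_mem a a.2⟩)
      map_add' := fun a b => by
        rw [← star_add, ← map_add]; congr 2; ext1; simp
      map_smul' := fun c a => by
        have : (⟨star (c • a : A), hA.star_mem _ (c • a).2⟩ : A)
          = star c • ⟨star (a : BH H), hA.star_mem a a.2⟩ := by ext1; simp
        rw [this, map_smul, star_smul, star_star]; rfl }
  map_add' φ ψ := by ext1 a; simp
  map_smul' c φ := by ext1 a; simp

theorem hermConj_I_smul [CompleteSpace H] {A : Submodule ℂ (BH H)} (hA : IsOperatorSystem A)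
    (φ : A →ₗ[ℂ] BH H) : hermConj hA (Complex.I • φ) = -(Complex.I • hermConj hA φ) := by
  ext1 a; simp [hermConj]

theorem IsPositiveMap.hermConj_eq [CompleteSpace H] {A : Submodule ℂ (BH H)}
    (hA : IsOperatorSystem A) {φ : A →ₗ[ℂ] BH H} (hφ : IsPositiveMap φ) :
    hermConj hA φ = φ := by
  ext1 a
  simp [hermConj, hφ.star_apply hA]

/-! ### Conjugation maps are completely positive -/

/-- The map `b ↦ v* b v`. -/
noncomputable def conjMap [CompleteSpace H] (v : BH H) : Maps H :=
  (ContinuousLinearMap.mul ℂ (BH H) (star v)).comp ((ContinuousLinearMap.mul ℂ (BH H)).flip v)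

theorem conjMap_apply [CompleteSpace H] (v b : BH H) : conjMap v b = star v * (b * v) := rfl

theorem conjMap_mem_cpMaps [CompleteSpace H] (v : BH H) : conjMap v ∈ cpMaps H := by
  refine ⟨⟨(conjMap v : BH H →ₗ[ℂ] BH H), fun k M hM => ?_⟩, fun a => rfl⟩
  -- Applied entrywise, `conjMap v` is conjugation by the diagonal matrix with entries `v`.
  let D : CStarMatrix (Fin k) (Fin k) (BH H) := CStarMatrix.ofMatrix (Matrix.diagonal fun _ => v)
  have h : M.map (conjMap v : BH H →ₗ[ℂ] BH H) = star D * M * D := by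
    ext1 i j
    have hD : star D = CStarMatrix.ofMatrix (Matrix.diagonal fun _ => star v) := by
      ext1 i j
      by_cases h : i = j
      · subst h; simp [D, CStarMatrix.star_apply]
      · simp [D, CStarMatrix.star_apply, Matrix.diagonal, h, Ne.symm h]
    rw [hD]
    simp [D, CStarMatrix.mul_apply, Matrix.diagonal, conjMap_apply, mul_assoc]
  rw [h]
  exact star_left_conjugate_nonneg hM D

/-! ### Closedness of the cone of restrictions -/

theorem norm_apply_le_of_mem_positiveMaps [CompleteSpace H] {ψ : Maps H}
    (hψ : ψ ∈ positiveMaps H) (x : BH H) : ‖ψ x‖ ≤ 4 * ‖ψ 1‖ * ‖x‖ := by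
  let f : BH H →ₚ[ℂ] BH H := .mk₀ (ψ : BH H →ₗ[ℂ] BH H) hψ
  obtain ⟨y, hy_nonneg, hy_norm, hy⟩ := CStarAlgebra.exists_sum_four_nonneg x
  conv_lhs => rw [hy]
  simp only [map_sum, map_smul]
  calc _ ≤ ∑ i : Fin 4, ‖ψ 1‖ * ‖x‖ := by
        refine norm_sum_le_of_le _ fun i _ => ?_
        rw [norm_smul, norm_pow, Complex.norm_I, one_pow, one_mul]
        refine (f.norm_apply_le_of_nonneg _ (hy_nonneg i)).trans ?_
        exact mul_le_mul_of_nonneg_left (hy_norm i) (norm_nonneg _)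
    _ = _ := by simp [mul_assoc]

/-- For `p : B(H) → A`, the map `θ ↦ θ ∘ p` extending linear maps on `A` to `B(H)`; it is used with
`p` a projection onto `A`. -/
noncomputable def extendAlong [FiniteDimensional ℂ H] {A : Submodule ℂ (BH H)} (p : BH H →ₗ[ℂ] A) :
    (A →ₗ[ℂ] BH H) →ₗ[ℂ] Maps H where
  toFun θ := LinearMap.toContinuousLinearMap (θ ∘ₗ p)
  map_add' θ θ' := by ext1 b; simp
  map_smul' c θ := by ext1 b; simp

theorem extendAlong_apply [FiniteDimensional ℂ H] {A : Submodule ℂ (BH H)} (p : BH H →ₗ[ℂ] A)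
    (θ : A →ₗ[ℂ] BH H) (b : BH H) : extendAlong p θ b = θ (p b) := rfl

/-- The restriction of a map to `A`. -/
def restrict (A : Submodule ℂ (BH H)) : Maps H →ₗ[ℂ] (A →ₗ[ℂ] BH H) where
  toFun ψ := (ψ : BH H →ₗ[ℂ] BH H) ∘ₗ A.subtype
  map_add' _ _ := rfl
  map_smul' _ _ := rfl

theorem restrict_apply (A : Submodule ℂ (BH H)) (ψ : Maps H) (a : A) :
    restrict A ψ a = ψ a := rfl

/-- The restrictions to `A` of the maps in `K` form a closed set. To have a topology at hand, a map on
`A` is represented by its extension along a projection `p` onto `A`. A bound on the restriction of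
`ψ ∈ K` bounds `ψ 1`, hence `ψ`, so that compactness applies. -/
theorem isClosed_image_restrict [CompleteSpace H] [FiniteDimensional ℂ H]
    {A : Submodule ℂ (BH H)} (hA : IsOperatorSystem A)
    {K : PointedCone ℝ (Maps H)} (hK : IsMappingCone K) {p : BH H →ₗ[ℂ] A}
    (hp : ∀ a : A, p a = a) :
    IsClosed ((fun ψ => extendAlong p (restrict A ψ)) '' (K : Set (Maps H))) := by
  have : ProperSpace (Maps H) := FiniteDimensional.proper ℂ _
  refine IsSeqClosed.isClosed fun θ θ₀ hθ hlim => ?_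
  choose ψ hψK hψ using hθ
  obtain ⟨C, hC⟩ := hlim.norm.bddAbove_range
  have hbd : ∀ n, ‖ψ n‖ ≤ 4 * (C * ‖(1 : BH H)‖) := fun n => by
    have h1 : ‖ψ n 1‖ ≤ C * ‖(1 : BH H)‖ := by
      have : ψ n 1 = θ n 1 := by
        rw [← hψ n, extendAlong_apply, restrict_apply, hp ⟨1, hA.one_mem⟩]
      rw [this]
      refine ((θ n).le_opNorm _).trans ?_
      exact mul_le_mul_of_nonneg_right (hC ⟨n, rfl⟩) (norm_nonneg _)
    have h0 := (norm_nonneg _).trans h1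
    refine (ψ n).opNorm_le_bound (by positivity) fun x => ?_
    refine (norm_apply_le_of_mem_positiveMaps (hK.positive _ (hψK n)) x).trans ?_
    gcongr
  obtain ⟨ψ₀, -, u, hu', hu⟩ := tendsto_subseq_of_bounded (Metric.isBounded_closedBall
    (x := (0 : Maps H)) (r := 4 * (C * ‖(1 : BH H)‖))) (x := ψ) fun n => by simpa using hbd n
  refine ⟨ψ₀, hK.isClosed.mem_of_tendsto hu (.of_forall fun n => hψK _), ?_⟩
  refine tendsto_nhds_unique (((extendAlong p ∘ₗ restrict A).continuous_of_finiteDimensional.tendsto _).comp hu) ?_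
  exact (hlim.comp hu'.tendsto_atTop).congr fun n => (hψ (u n)).symm

end

section

variable {H : Type*} [NormedAddCommGroup H] [InnerProductSpace ℂ H] {ι : Type*} [Fintype ι]
  [FiniteDimensional ℂ H] (e : OrthonormalBasis ι ℂ H)

/-! ### The trace pairing -/

theorem tildeFunctional_tmul {A : Submodule ℂ (BH H)} (φ : A →ₗ[ℂ] BH H) (a : A) (b : BH H) :
    tildeFunctional e φ (a ⊗ₜ b) = tr (φ a * transposeMap e b) := by
  rfl

omit [FiniteDimensional ℂ H] in
theorem ext_inner_basis {a b : BH H}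
    (h : ∀ i j, inner ℂ (e i) (a (e j)) = inner ℂ (e i) (b (e j))) : a = b := by
  rw [← sum_matrixUnit e a, ← sum_matrixUnit e b]
  simp only [h]

theorem transposeMap_transposeMap (a : BH H) : transposeMap e (transposeMap e a) = a :=
  ext_inner_basis e fun i j => by rw [inner_transposeMap, inner_transposeMap]

theorem tr_mul_eq_sum (a b : BH H) :
    tr (a * b) = ∑ i, ∑ j, inner ℂ (e i) (a (e j)) * inner ℂ (e j) (b (e i)) := by
  conv_lhs => rw [← sum_matrixUnit e b]
  simp only [Finset.mul_sum, mul_smul_comm, tr, ContinuousLinearMap.toLinearMap_sum,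
    ContinuousLinearMap.toLinearMap_smul, map_sum, map_smul]
  change ∑ j, ∑ i, inner ℂ (e j) (b (e i)) • tr (a * matrixUnit e j i) = _
  simp only [tr_mul_matrixUnit, smul_eq_mul]
  rw [Finset.sum_comm]
  simp only [mul_comm]

theorem eq_zero_of_tr_mul_eq_zero {a : BH H} (h : ∀ b, tr (a * transposeMap e b) = 0) : a = 0 :=
  ext_inner_basis e fun i j => by
    rw [← tr_mul_matrixUnit, ← transposeMap_transposeMap e (matrixUnit e j i), h]; simp

/-- If `ψ` is the adjoint of `α` for the pairing `Tr(a bᵗ)`, then `ψ̃ = ι̃ ∘ (ι ⊗ α)` on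
`A ⊗ B(H)`. -/
theorem tildeFunctional_restrict (A : Submodule ℂ (BH H)) (ψ α : Maps H)
    (h : ∀ a b, tr (ψ a * transposeMap e b) = tr (a * transposeMap e (α b)))
    (x : A ⊗[ℂ] BH H) :
    tildeFunctional e (restrict A ψ) x =
      tildeFunctional e A.subtype (LinearMap.lTensor A (α : BH H →ₗ[ℂ] BH H) x) := by
  induction x with
  | zero => simp
  | add x y hx hy => simp only [map_add, hx, hy]
  | tmul a b => simpa [tildeFunctional_tmul, restrict_apply] using h a b

theorem tr_apply_mul_transposeMap (ψ : Maps H) (a b : BH H) :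
    tr (ψ a * transposeMap e b) =
      tr (a * transposeMap e (mapTranspose e (mapAdjoint e ψ) b)) := by
  simp [mapTranspose, transposeMap_transposeMap, tr_mul_mapAdjoint e]

theorem tr_mapAdjoint_mapTranspose_mul (α : Maps H) (a b : BH H) :
    tr (mapAdjoint e (mapTranspose e α) a * transposeMap e b) =
      tr (a * transposeMap e (α b)) := by
  rw [tr_mul_comm, ← tr_mul_mapAdjoint, tr_mul_comm]
  simp [mapTranspose, transposeMap_transposeMap]

/-- Every vector of `H ⊗ H` is `(1 ⊗ v) Ω` with `Ω = ∑ i, e i ⊗ e i`. -/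
theorem exists_eq_sum_tmul (ξ : H ⊗[ℂ] H) : ∃ v : BH H, ξ = ∑ i, e i ⊗ₜ v (e i) := by
  induction ξ with
  | zero => exact ⟨0, by simp⟩
  | add x y hx hy =>
    obtain ⟨v, rfl⟩ := hx
    obtain ⟨w, rfl⟩ := hy
    exact ⟨v + w, by simp [TensorProduct.tmul_add, Finset.sum_add_distrib]⟩
  | tmul x y =>
    refine ⟨LinearMap.toContinuousLinearMap
      (e.toBasis.constr ℂ fun i => (inner ℂ (e i) x : ℂ) • y), ?_⟩
    conv_lhs => rw [← e.sum_repr' x]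
    have (i : ι) := e.toBasis.constr_basis ℂ (fun i => (inner ℂ (e i) x : ℂ) • y) i
    simp only [OrthonormalBasis.coe_toBasis] at this
    simp [TensorProduct.sum_tmul, this, TensorProduct.smul_tmul]

/-- `⟪ξ, x ξ⟫ = ι̃ ((ι ⊗ Ad v) x)` for `ξ = (1 ⊗ v) Ω`. -/
theorem inner_toOperator [CompleteSpace H] (A : Submodule ℂ (BH H)) (v : BH H)
    (x : A ⊗[ℂ] BH H) :
    inner ℂ (∑ i, e i ⊗ₜ v (e i) : H ⊗[ℂ] H) (toOperator A x (∑ i, e i ⊗ₜ v (e i))) =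
      tildeFunctional e A.subtype
        (LinearMap.lTensor A (conjMap v : BH H →ₗ[ℂ] BH H) x) := by
  induction x with
  | zero => simp
  | add x y hx hy => simp only [map_add, add_apply, inner_add_right, hx, hy]
  | tmul a b =>
    simp [tildeFunctional_tmul, toOperator_tmul, tr_mul_eq_sum e, inner_transposeMap,
      conjMap_apply, sum_inner, inner_sum, ContinuousLinearMap.star_eq_adjoint,
      ContinuousLinearMap.adjoint_inner_right]
    rw [Finset.sum_comm]

theorem tildeFunctional_subtype_nonneg [CompleteSpace H] {A : Submodule ℂ (BH H)}
    {x : A ⊗[ℂ] BH H} (hx : 0 ≤ toOperator A x) : 0 ≤ tildeFunctional e A.subtype x := by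
  have h := inner_toOperator e A 1 x
  have h1 : conjMap (1 : BH H) = ContinuousLinearMap.id ℂ (BH H) := by
    ext1 b; simp [conjMap_apply]
  rw [h1] at h
  simp only [ContinuousLinearMap.coe_id, LinearMap.lTensor_id, LinearMap.id_apply] at h
  rw [← h]
  exact ((ContinuousLinearMap.nonneg_iff_isPositive _).1 hx).inner_nonneg_right _

/-- Every functional on the linear maps `A → B(H)` is evaluation of `θ̃` at some `x ∈ A ⊗ B(H)`, since
`θ ↦ θ̃` is injective and `A ⊗ B(H)` is reflexive. -/
theorem exists_tildeFunctional_eq (A : Submodule ℂ (BH H)) (g : (A →ₗ[ℂ] BH H) →ₗ[ℂ] ℂ) :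
    ∃ x : A ⊗[ℂ] BH H, ∀ θ, g θ = tildeFunctional e θ x := by
  let T : (A →ₗ[ℂ] BH H) →ₗ[ℂ] Module.Dual ℂ (A ⊗[ℂ] BH H) :=
    { toFun := fun θ => tildeFunctional e θ
      map_add' := fun θ θ' => by
        ext a b; simp [tildeFunctional_tmul, tr, add_mul]
      map_smul' := fun c θ => by
        ext a b; simp [tildeFunctional_tmul, tr] }
  have hT : Function.Injective T := by
    refine (injective_iff_map_eq_zero T).2 fun θ hθ => ?_
    ext1 a
    refine eq_zero_of_tr_mul_eq_zero e fun b => ?_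
    rw [← tildeFunctional_tmul]
    exact LinearMap.congr_fun hθ (a ⊗ₜ b)
  obtain ⟨G, rfl⟩ := LinearMap.dualMap_surjective_of_injective hT g
  obtain ⟨x, rfl⟩ := (Module.evalEquiv ℂ (A ⊗[ℂ] BH H)).surjective G
  exact ⟨x, fun θ => rfl⟩

/-! ### Duality between `P(A, K)` and `K` -/

theorem mem_conePAK_of_nonneg [CompleteSpace H] {A : Submodule ℂ (BH H)}
    {K : PointedCone ℝ (Maps H)} (hK : IsMappingCone K) (hKs : IsSymmetric e K)
    {x : A ⊗[ℂ] BH H}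
    (hx : ∀ ψ ∈ K, 0 ≤ tildeFunctional e (restrict A ψ) x) :
    x ∈ conePAK A K := by
  intro α hα
  rw [ContinuousLinearMap.nonneg_iff_isPositive, ContinuousLinearMap.isPositive_iff_complex]
  intro ξ
  obtain ⟨v, rfl⟩ := exists_eq_sum_tmul e ξ
  have hβ : (conjMap v).comp α ∈ K := hK.comp_left α hα _ (conjMap_mem_cpMaps v)
  have h := hx _ ((hKs.mem_iff_adjoint _).1 ((hKs.mem_iff_transpose _).1 hβ))
  rw [tildeFunctional_restrict e A _ _ (tr_mapAdjoint_mapTranspose_mul e _),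
    ContinuousLinearMap.toLinearMap_comp, LinearMap.lTensor_comp_apply,
    ← inner_toOperator e] at h
  rw [← inner_conj_symm]
  generalize (inner ℂ (_ : H ⊗[ℂ] H) _ : ℂ) = z at h ⊢
  obtain ⟨h1, h2⟩ := Complex.nonneg_iff.1 h
  refine ⟨Complex.ext ?_ ?_, ?_⟩
  · simp
  · simp [← h2]
  · simpa using h1

end

end MappingCones
open MappingCones in
theorem theorem2 {H : Type*} [NormedAddCommGroup H] [InnerProductSpace ℂ H] [CompleteSpace H]
    [FiniteDimensional ℂ H] {ι : Type*} [Fintype ι] (e : OrthonormalBasis ι ℂ H)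
    (A : Submodule ℂ (BH H)) (hA : IsOperatorSystem A)
    (K : PointedCone ℝ (Maps H)) (hK : IsMappingCone K) (hKs : IsSymmetric e K)
    (φ : A →ₗ[ℂ] BH H) (hφ : IsPositiveMap φ) :
    IsKPositive e K φ ↔ ∃ ψ ∈ K, ∀ a : A, φ a = ψ a := by
  constructor
  · intro hpos
    by_contra hno
    obtain ⟨p, hp⟩ := A.subtype.exists_leftInverse_of_injective A.ker_subtype
    replace hp (a : A) : p a = a := LinearMap.congr_fun hp a
    let E : Maps H →ₗ[ℂ] Maps H := extendAlong p ∘ₗ restrict A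
    have hmem : extendAlong p φ ∉ E '' (K : Set (Maps H)) := by
      rintro ⟨ψ, hψ, h⟩
      refine hno ⟨ψ, hψ, fun a => ?_⟩
      have := DFunLike.congr_fun h (a : BH H)
      simpa [E, extendAlong_apply, restrict_apply, hp] using this.symm
    have hconv : Convex ℝ (E '' (K : Set (Maps H))) :=
      K.convex.linear_image (E.restrictScalars ℝ)
    obtain ⟨f, u, hfu, hu⟩ :=
      geometric_hahn_banach_point_closed hconv (isClosed_image_restrict hA hK hp) hmem
    have hu0 : u < 0 := by simpa using hu _ ⟨0, K.zero_mem, map_zero _⟩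
    -- `f` is bounded below on a cone, hence nonnegative there.
    have hf : ∀ ψ ∈ K, 0 ≤ f (E ψ) := by
      intro ψ hψ
      by_contra! hneg
      have h := hu _ ⟨(u / f (E ψ)) • ψ,
        K.smul_mem (div_pos_of_neg_of_neg hu0 hneg).le hψ, rfl⟩
      rw [← LinearMap.restrictScalars_apply ℝ E, map_smul, LinearMap.restrictScalars_apply, map_smul, smul_eq_mul, div_mul_cancel₀ _ hneg.ne] at h
      exact h.false
    -- `F` is `f` averaged over the involution `hermConj`, which makes `F` vanish at `i θ` for `θ`
    -- positive, and its complexification real at `θ`.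
    let F : Module.Dual ℝ (A →ₗ[ℂ] BH H) :=
      (f : Maps H →ₗ[ℝ] ℝ) ∘ₗ (extendAlong p).restrictScalars ℝ ∘ₗ (LinearMap.id + hermConj hA)
    have hF : ∀ θ : A →ₗ[ℂ] BH H, IsPositiveMap θ →
        F.extendRCLike (𝕜 := ℂ) θ = ((2 * f (extendAlong p θ) : ℝ) : ℂ) := by
      intro θ hθ
      have h1 : F (Complex.I • θ) = 0 := by
        simp [F, hermConj_I_smul, hθ.hermConj_eq hA]
      have h2 : F θ = 2 * f (extendAlong p θ) := by
        simp [F, hθ.hermConj_eq hA, two_mul]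
      rw [Module.Dual.extendRCLike_apply]
      simp [h1, h2]
    obtain ⟨x, hx⟩ := exists_tildeFunctional_eq e A (F.extendRCLike (𝕜 := ℂ))
    have hxP : x ∈ conePAK A K := by
      refine mem_conePAK_of_nonneg e hK hKs fun ψ hψ => ?_
      rw [← hx, hF _ fun a ha => hK.positive ψ hψ _ ha, Complex.zero_le_real]
      exact mul_nonneg zero_le_two (hf ψ hψ)
    have h := hpos x hxP
    rw [← hx, hF φ hφ, Complex.zero_le_real] at h
    linarith
  · rintro ⟨ψ, hψ, h⟩ x hx
    obtain rfl : φ = restrict A ψ := LinearMap.ext h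
    rw [tildeFunctional_restrict e A ψ _ (tr_apply_mul_transposeMap e ψ)]
    exact tildeFunctional_subtype_nonneg e
      (hx _ ((hKs.mem_iff_transpose _).1 ((hKs.mem_iff_adjoint _).1 hψ)))
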